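/- Let $C$ be a field of characteristic zero, and let $S_x$, $S_k$ denote the shifts $x\mapsto x+1$ and $k\mapsto k+1$ on $C(x,y,k)$, extended to some extension field $E$ of $C(x,y,k)$. In $E$, a term $\alpha^x$ (with $\alpha\in C[y]\setminus\{0\}$) is understood as a nonzero element $e$ with $S_x(e)=\alpha e$, $S_k(e)=e$; a term $\beta^k$ as a nonzero element $e$ with $S_x(e)=e$, $S_k(e)=\beta e$; and a term $\Gamma(z)$, where $z=sx+tk+w$ with $s,t\in\mathbb Z$, $w\in C[y]$, as a nonzero element on which $S_x$ and $S_k$ act as $\Gamma(z)\mapsto\Gamma(z+s)$ and $\Gamma(z)\mapsto\Gamma(z+t)$, according to the rule $\Gamma(z+1)=z\Gamma(z)$. An element $H\in E$ is called a proper hypergeometric term if it can be written as $$H=p\,\alpha^x\beta^k\prod_{m=1}^M\frac{\Gamma(A_m)\,\Gamma(B_m)}{\Gamma(U_m)\,\Gamma(V_m)},\qquad \begin{aligned}A_m&=a_mx+a_m'k+a_m'',& B_m&=b_mx-b_m'k+b_m'',\\ U_m&=u_mx+u_m'k+u_m'',& V_m&=v_mx-v_m'k+v_m'',\end{aligned}$$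 with $p\in C[x,y,k]\setminus\{0\}$, $\alpha,\beta\in C[y]\setminus\{0\}$, $M\in\mathbb N$, $a_m,a_m',b_m,b_m',u_m,u_m',v_m,v_m'\in\mathbb N=\{0,1,2,\dots\}$ and $a_m'',b_m'',u_m'',v_m''\in C[y]$. Let $H$ be a proper hypergeometric term, written in this form, and assume that $H$ cannot be split as $H=fH_0$ with $f\in C(x,y,k)$ and a proper hypergeometric term $H_0$ satisfying $S_k(H_0)/H_0=1$. Put $\vartheta_x=\deg_x p$, $\vartheta_y=\deg_y p$, $\vartheta_k=\deg_k p$ and \begin{align*} \mu&=\max\Big\{\sum_{m=1}^M(a_m+b_m),\ \sum_{m=1}^M(u_m+v_m)\Big\},\\ \nu&=\max\Big\{\sum_{m=1}^M(a_m'+v_m'),\ \sum_{m=1}^M(u_m'+b_m')\Big\},\\ \xi&=\max\Big\{\deg_y\alpha+\sum_{m=1}^M(a_m\deg_yA_m+b_m\deg_yB_m),\ \sum_{m=1}^M(u_m\deg_yU_m+v_m\deg_yV_m)\Big\},\\ \eta&=\max\Big\{\deg_y\beta+\sum_{m=1}^M(a_m'\deg_yA_m+v_m'\deg_yV_m),\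 \sum_{m=1}^M(u_m'\deg_yU_m+b_m'\deg_yB_m)\Big\}, \end{align*} where $\deg_y 0$ is read as $0$. Let $r,d,h\in\mathbb N$ be such that $d+\vartheta_x+r\mu-\nu\ge0$, $h+\vartheta_y+r\xi-\eta\ge0$, $\vartheta_k+r\mu-\nu\ge0$ and \begin{align*} (r+1)(d+1)(h+1)&-(d+1+\vartheta_x+r\mu)(\vartheta_k+r\mu+1)\,\eta\\ &-(d+2+\vartheta_x+\vartheta_k+2r\mu-\nu)(h+1+\vartheta_y+r\xi-\eta)\,\nu>0. \end{align*} Then $H$ has a telescoper of order at most $r$, degree at most $d$ and height at most $h$. That is, there are polynomials $c_0,\dots,c_r\in C[x,y]$, not all zero, with $\deg_x c_i\le d$ and $\deg_y c_i\le h$ for all $i$, and a rational function $g\in C(x,y,k)$, such that $$c_0H+c_1S_x(H)+\cdots+c_rS_x^r(H)=S_k(gH)-gH.$$ -/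

import Mathlib

open scoped Polynomial

noncomputable section

namespace Telescoping

/-- The polynomial ring `C[x, y]`, with `x = X 0` and `y = X 1`. -/
abbrev PolyXY (C : Type*) [Field C] := MvPolynomial (Fin 2) C

/-- The polynomial ring `C[x, y, k]`, with `x = X 0`, `y = X 1` and `k = X 2`. -/
abbrev PolyXYK (C : Type*) [Field C] := MvPolynomial (Fin 3) C

/-- The field of rational functions `C(x, y, k)`. -/
abbrev RatXYK (C : Type*) [Field C] := FractionRing (PolyXYK C)

/-- The automorphism of `C[x, y, k]` that maps the variable number `i` to itself plus one and
fixes the other two variables and the field `C`. -/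
def polyShift (C : Type*) [Field C] (i : Fin 3) : PolyXYK C ≃ₐ[C] PolyXYK C :=
  AlgEquiv.ofAlgHom
    (MvPolynomial.aeval fun j => if j = i then MvPolynomial.X j + 1 else MvPolynomial.X j)
    (MvPolynomial.aeval fun j => if j = i then MvPolynomial.X j - 1 else MvPolynomial.X j)
    (by ext j : 1; by_cases h : j = i <;> simp [h])
    (by ext j : 1; by_cases h : j = i <;> simp [h])

/-- The shift of the variable number `i`, as an automorphism of `C(x, y, k)`. -/
def ratShift (C : Type*) [Field C] (i : Fin 3) : RatXYK C ≃+* RatXYK C :=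
  IsFractionRing.ringEquivOfRingEquiv (polyShift C i).toRingEquiv

/-- The inclusion of `C[x, y]` into `C(x, y, k)`. -/
def ofXY (C : Type*) [Field C] : PolyXY C →+* RatXYK C :=
  (algebraMap (PolyXYK C) (RatXYK C)).comp
    (MvPolynomial.rename (R := C) (Fin.castSucc : Fin 2 → Fin 3)).toRingHom

/-- The inclusion of `C[y]` into `C[x, y, k]`. -/
def ofY (C : Type*) [Field C] : C[X] →ₐ[C] PolyXYK C :=
  Polynomial.aeval (MvPolynomial.X 1)

/-- Extensions of the two shifts `S_x` and `S_k` from `C(x, y, k)` to an extension field `E`.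
Neither bijectivity nor commutativity of the extended shifts is required. -/
structure ShiftExtension (C : Type*) [Field C] (E : Type*) [Field E] [Algebra (RatXYK C) E] where
  /-- the shift of `x` -/
  Sx : E →+* E
  /-- the shift of `k` -/
  Sk : E →+* E
  Sx_algebraMap : ∀ f : RatXYK C,
    Sx (algebraMap (RatXYK C) E f) = algebraMap (RatXYK C) E (ratShift C 0 f)
  Sk_algebraMap : ∀ f : RatXYK C,
    Sk (algebraMap (RatXYK C) E f) = algebraMap (RatXYK C) E (ratShift C 2 f)

/-- The polynomial `s x + t k + w` for integers `s`, `t` and `w ∈ C[y]`. -/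
def linForm {C : Type*} [Field C] (s t : ℤ) (w : C[X]) : PolyXYK C :=
  (s : PolyXYK C) * MvPolynomial.X 0 + (t : PolyXYK C) * MvPolynomial.X 2 + ofY C w

/-- The quotient `Γ(z + n) / Γ(z)`: it is `z (z + 1) ⋯ (z + n - 1)` for `n ≥ 0`, and
`1 / ((z - 1) (z - 2) ⋯ (z + n))` for `n < 0`. -/
def gammaQuotient {K : Type*} [Field K] (z : K) : ℤ → K
  | Int.ofNat n => ∏ i ∈ Finset.range n, (z + i)
  | Int.negSucc n => (∏ i ∈ Finset.range (n + 1), (z - (i + 1)))⁻¹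

section Terms

variable {C : Type*} [Field C] {E : Type*} [Field E] [Algebra (RatXYK C) E]

/-- `H` is a hypergeometric term with respect to `x` and `k`: it is nonzero, and its two shift
quotients lie in `C(x, y, k)`. -/
def IsHypergeometric (S : ShiftExtension C E) (H : E) : Prop :=
  H ≠ 0 ∧ (∃ q : RatXYK C, S.Sx H / H = algebraMap (RatXYK C) E q) ∧
    ∃ q : RatXYK C, S.Sk H / H = algebraMap (RatXYK C) E q

/-- `g` is a term `α ^ x`. -/
def IsPowX (S : ShiftExtension C E) (α : C[X]) (g : E) : Prop :=
  g ≠ 0 ∧ S.Sx g = algebraMap (RatXYK C) E (algebraMap (PolyXYK C) (RatXYK C) (ofY C α)) * g ∧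
    S.Sk g = g

/-- `g` is a term `β ^ k`. -/
def IsPowK (S : ShiftExtension C E) (β : C[X]) (g : E) : Prop :=
  g ≠ 0 ∧ S.Sx g = g ∧
    S.Sk g = algebraMap (RatXYK C) E (algebraMap (PolyXYK C) (RatXYK C) (ofY C β)) * g

/-- `g` is a term `Γ(s x + t k + w)`: a nonzero element on which the shifts `S_x` and `S_k` act
as `Γ(z) ↦ Γ(z + s)` and `Γ(z) ↦ Γ(z + t)`, where `z = s x + t k + w`. -/
def IsGamma (S : ShiftExtension C E) (s t : ℤ) (w : C[X]) (g : E) : Prop :=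
  g ≠ 0 ∧
    S.Sx g = algebraMap (RatXYK C) E
      (gammaQuotient (algebraMap (PolyXYK C) (RatXYK C) (linForm s t w)) s) * g ∧
    S.Sk g = algebraMap (RatXYK C) E
      (gammaQuotient (algebraMap (PolyXYK C) (RatXYK C) (linForm s t w)) t) * g

end Terms

/-- The data of an expression
`p α^x β^k ∏ₘ Γ(aₘ x + aₘ' k + aₘ'') Γ(bₘ x - bₘ' k + bₘ'') /
  (Γ(uₘ x + uₘ' k + uₘ'') Γ(vₘ x - vₘ' k + vₘ''))`.
In the names of the fields the primes are replaced by the numbers 1 and 2. -/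
structure ProperForm (C : Type*) [Field C] where
  p : PolyXYK C
  p_ne_zero : p ≠ 0
  α : C[X]
  α_ne_zero : α ≠ 0
  β : C[X]
  β_ne_zero : β ≠ 0
  M : ℕ
  (a a1 b b1 u u1 v v1 : Fin M → ℕ)
  (a2 b2 u2 v2 : Fin M → C[X])

namespace ProperForm

variable {C : Type*} [Field C] (D : ProperForm C)

/-- `Aₘ = aₘ x + aₘ' k + aₘ''` -/
def A (m : Fin D.M) : PolyXYK C := linForm (D.a m) (D.a1 m) (D.a2 m)

/-- `Bₘ = bₘ x - bₘ' k + bₘ''` -/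
def B (m : Fin D.M) : PolyXYK C := linForm (D.b m) (-(D.b1 m : ℤ)) (D.b2 m)

/-- `Uₘ = uₘ x + uₘ' k + uₘ''` -/
def U (m : Fin D.M) : PolyXYK C := linForm (D.u m) (D.u1 m) (D.u2 m)

/-- `Vₘ = vₘ x - vₘ' k + vₘ''` -/
def V (m : Fin D.M) : PolyXYK C := linForm (D.v m) (-(D.v1 m : ℤ)) (D.v2 m)

/-- `ϑ_x = deg_x p` -/
def thetaX : ℕ := D.p.degreeOf 0

/-- `ϑ_y = deg_y p` -/
def thetaY : ℕ := D.p.degreeOf 1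

/-- `ϑ_k = deg_k p` -/
def thetaK : ℕ := D.p.degreeOf 2

/-- `μ = max {∑ (aₘ + bₘ), ∑ (uₘ + vₘ)}` -/
def mu : ℕ := max (∑ m, (D.a m + D.b m)) (∑ m, (D.u m + D.v m))

/-- `ν = max {∑ (aₘ' + vₘ'), ∑ (uₘ' + bₘ')}` -/
def nu : ℕ := max (∑ m, (D.a1 m + D.v1 m)) (∑ m, (D.u1 m + D.b1 m))

/-- `ξ = max {deg_y α + ∑ (aₘ deg_y Aₘ + bₘ deg_y Bₘ), ∑ (uₘ deg_y Uₘ + vₘ deg_y Vₘ)}` -/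
def xi : ℕ :=
  max (D.α.natDegree + ∑ m, (D.a m * (D.A m).degreeOf 1 + D.b m * (D.B m).degreeOf 1))
    (∑ m, (D.u m * (D.U m).degreeOf 1 + D.v m * (D.V m).degreeOf 1))

/-- `η = max {deg_y β + ∑ (aₘ' deg_y Aₘ + vₘ' deg_y Vₘ), ∑ (uₘ' deg_y Uₘ + bₘ' deg_y Bₘ)}` -/
def eta : ℕ :=
  max (D.β.natDegree + ∑ m, (D.a1 m * (D.A m).degreeOf 1 + D.v1 m * (D.V m).degreeOf 1))
    (∑ m, (D.u1 m * (D.U m).degreeOf 1 + D.b1 m * (D.B m).degreeOf 1))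

/-- The element `H` of `E` is given by the expression `D`. -/
def IsFormOf {E : Type*} [Field E] [Algebra (RatXYK C) E] (S : ShiftExtension C E) (H : E) :
    Prop :=
  ∃ (ex ek : E) (gA gB gU gV : Fin D.M → E),
    IsPowX S D.α ex ∧ IsPowK S D.β ek ∧
    (∀ m, IsGamma S (D.a m) (D.a1 m) (D.a2 m) (gA m)) ∧
    (∀ m, IsGamma S (D.b m) (-(D.b1 m : ℤ)) (D.b2 m) (gB m)) ∧
    (∀ m, IsGamma S (D.u m) (D.u1 m) (D.u2 m) (gU m)) ∧
    (∀ m, IsGamma S (D.v m) (-(D.v1 m : ℤ)) (D.v2 m) (gV m)) ∧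
    H = algebraMap (RatXYK C) E (algebraMap (PolyXYK C) (RatXYK C) D.p) * ex * ek *
      ∏ m, (gA m * gB m) / (gU m * gV m)

end ProperForm

section Telescopers

variable {C : Type*} [Field C] {E : Type*} [Field E] [Algebra (RatXYK C) E]

/-- `H` is a proper hypergeometric term. -/
def IsProperHypergeometric (S : ShiftExtension C E) (H : E) : Prop :=
  IsHypergeometric S H ∧ ∃ D : ProperForm C, D.IsFormOf S H

/-- `H` can be split as `H = f H₀` with `f ∈ C(x, y, k)` and a proper hypergeometric term `H₀`
such that `S_k(H₀) / H₀ = 1`. -/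
def IsRationalUpToConstant (S : ShiftExtension C E) (H : E) : Prop :=
  ∃ (f : RatXYK C) (H₀ : E), IsProperHypergeometric S H₀ ∧ S.Sk H₀ / H₀ = 1 ∧
    H = algebraMap (RatXYK C) E f * H₀

/-- Operators `c_0 + c_1 S_x + ⋯ + c_r S_x^r` with coefficients in `C[x, y]` written on the left.
The product of two operators is not needed below. -/
abbrev Operator (C : Type*) [Field C] := SkewPolynomial (PolyXY C)

namespace Operator

/-- The order of an operator, which is its degree in `S_x`. -/
def order (L : Operator C) : ℕ := (SkewPolynomial.support L).sup id

/-- The degree of an operator, which is its degree in `x`. -/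
def degree (L : Operator C) : ℕ :=
  (SkewPolynomial.support L).sup fun i => (SkewPolynomial.coeff L i).degreeOf 0

/-- The height of an operator, which is its degree in `y`. -/
def height (L : Operator C) : ℕ :=
  (SkewPolynomial.support L).sup fun i => (SkewPolynomial.coeff L i).degreeOf 1

/-- The action `L(H) = ∑ c_i S_x^i(H)`. -/
def apply (S : ShiftExtension C E) (L : Operator C) (H : E) : E :=
  ∑ i ∈ SkewPolynomial.support L,
    algebraMap (RatXYK C) E (ofXY C (SkewPolynomial.coeff L i)) * S.Sx^[i] H

end Operator

/-- `L` is a telescoper for `H`: it is nonzero, and there is a certificate `g ∈ C(x, y, k)` with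
`L(H) = S_k(g H) - g H`. -/
def IsTelescoper (S : ShiftExtension C E) (H : E) (L : Operator C) : Prop :=
  L ≠ 0 ∧ ∃ g : RatXYK C, Operator.apply S L H =
    S.Sk (algebraMap (RatXYK C) E g * H) - algebraMap (RatXYK C) E g * H

end Telescopers

end Telescoping

end

open scoped Polynomial

noncomputable section

namespace Telescoping

section Box

variable {σ : Type*} (C : Type*) [Field C]

/-- The polynomials whose degree in the variable number `i` is at most `n i`. -/
def degreeBox (n : σ → ℕ) : Submodule C (MvPolynomial σ C) :=
  MvPolynomial.restrictSupport C {s | ∀ i, s i ≤ n i}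

variable {C}

theorem mem_degreeBox {n : σ → ℕ} {p : MvPolynomial σ C} :
    p ∈ degreeBox C n ↔ ∀ i, p.degreeOf i ≤ n i := by
  simp only [degreeBox, MvPolynomial.mem_restrictSupport_iff, MvPolynomial.degreeOf_le_iff]
  exact ⟨fun h i m hm => h hm i, fun h m hm i => h i m hm⟩

theorem mul_mem_degreeBox {m n : σ → ℕ} {p q : MvPolynomial σ C} (hp : p ∈ degreeBox C m)
    (hq : q ∈ degreeBox C n) : p * q ∈ degreeBox C (m + n) := by
  rw [mem_degreeBox] at *
  exact fun i => (MvPolynomial.degreeOf_mul_le i p q).trans (add_le_add (hp i) (hq i))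

theorem degreeBox_mono {m n : σ → ℕ} (h : m ≤ n) : degreeBox C m ≤ degreeBox C n :=
  fun _ hp => mem_degreeBox.2 fun i => (mem_degreeBox.1 hp i).trans (h i)

theorem prod_mem_degreeBox {ι : Type*} (s : Finset ι) (n : ι → σ → ℕ) (f : ι → MvPolynomial σ C)
    (h : ∀ j ∈ s, f j ∈ degreeBox C (n j)) : ∏ j ∈ s, f j ∈ degreeBox C (∑ j ∈ s, n j) := by
  rw [mem_degreeBox]
  intro i
  rw [Finset.sum_apply]
  exact (MvPolynomial.degreeOf_prod_le i s f).trans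
    (Finset.sum_le_sum fun j hj => mem_degreeBox.1 (h j hj) i)

theorem pow_mem_degreeBox {n : σ → ℕ} {p : MvPolynomial σ C} (h : p ∈ degreeBox C n) (k : ℕ) :
    p ^ k ∈ degreeBox C (k • n) := by
  simpa using prod_mem_degreeBox (Finset.range k) (fun _ => n) (fun _ => p) fun _ _ => h

theorem C_mem_degreeBox (c : C) (n : σ → ℕ) : MvPolynomial.C c ∈ degreeBox C n := by
  rw [mem_degreeBox]
  simp

theorem X_mem_degreeBox [DecidableEq σ] (i : σ) :
    MvPolynomial.X i ∈ degreeBox C (Pi.single i 1) := by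
  rw [mem_degreeBox]
  intro j
  rw [MvPolynomial.degreeOf_X]
  split_ifs with h
  · subst h; simp
  · exact zero_le

variable [Fintype σ]

/-- Exponent vectors below a bound correspond to tuples of elements of `Fin`. -/
def boxEquiv (n : σ → ℕ) : {s : σ →₀ ℕ | ∀ i, s i ≤ n i} ≃ (∀ i, Fin (n i + 1)) where
  toFun s i := ⟨s.1 i, Nat.lt_succ_of_le (s.2 i)⟩
  invFun t := ⟨Finsupp.equivFunOnFinite.symm fun i => t i, fun i => Nat.le_of_lt_succ (t i).2⟩
  left_inv s := by ext; rfl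
  right_inv t := by ext; rfl

/-- The monomials form a basis of `degreeBox`. -/
def degreeBoxBasis (n : σ → ℕ) : Module.Basis (∀ i, Fin (n i + 1)) C (degreeBox C n) :=
  (MvPolynomial.basisRestrictSupport C _).reindex (boxEquiv n)

instance (n : σ → ℕ) : FiniteDimensional C (degreeBox C n) := by
  classical exact .of_basis (degreeBoxBasis n)

theorem finrank_degreeBox (n : σ → ℕ) :
    Module.finrank C (degreeBox C n) = ∏ i, (n i + 1) := by
  classical
  rw [Module.finrank_eq_card_basis (degreeBoxBasis n)]
  simp

end Box

variable {C : Type*} [Field C]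

theorem polyShift_X (i j : Fin 3) : polyShift C i (MvPolynomial.X j) =
    if j = i then MvPolynomial.X j + 1 else MvPolynomial.X j := by
  simp [polyShift]

theorem polyShift_mem_degreeBox (i : Fin 3) {n : Fin 3 → ℕ} {p : PolyXYK C}
    (hp : p ∈ degreeBox C n) : polyShift C i p ∈ degreeBox C n := by
  rw [p.as_sum, map_sum]
  refine Submodule.sum_mem _ fun s hs => ?_
  rw [MvPolynomial.monomial_eq, map_mul, Finsupp.prod_fintype _ _ (by simp), map_prod]
  have hX : ∀ j, polyShift C i (MvPolynomial.X j) ∈ degreeBox C (Pi.single j 1) := by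
    intro j
    rw [polyShift_X]
    split_ifs
    · exact Submodule.add_mem _ (X_mem_degreeBox j) (by simpa using C_mem_degreeBox (1 : C) _)
    · exact X_mem_degreeBox j
  have hC : polyShift C i (MvPolynomial.C (p.coeff s)) = MvPolynomial.C (p.coeff s) :=
    (polyShift C i).commutes _
  have h := mul_mem_degreeBox (C_mem_degreeBox (p.coeff s) 0)
    (prod_mem_degreeBox Finset.univ _ _ fun j _ => pow_mem_degreeBox (hX j) (s j))
  rw [hC]
  simp only [map_pow]
  refine degreeBox_mono (fun j => ?_) h
  have hs' : s j ≤ n j :=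
    (MvPolynomial.monomial_le_degreeOf j hs).trans (mem_degreeBox.1 hp j)
  simpa [Finset.sum_apply, Pi.single_apply] using hs'

/-- The inclusion of `C[x, y]` into `C[x, y, k]`. -/
abbrev polyOfXY (C : Type*) [Field C] : PolyXY C →ₐ[C] PolyXYK C :=
  MvPolynomial.rename (R := C) (Fin.castSucc : Fin 2 → Fin 3)

theorem polyOfXY_mem_degreeBox {d h : ℕ} {c : PolyXY C} (hc : c ∈ degreeBox C ![d, h]) :
    polyOfXY C c ∈ degreeBox C ![d, h, 0] := by
  rw [mem_degreeBox] at *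
  have h0 := hc 0
  have h1 := hc 1
  intro i
  have key := fun j =>
    MvPolynomial.degreeOf_rename_of_injective (p := c) (Fin.castSucc_injective 2) j
  fin_cases i
  · exact (key 0).trans_le h0
  · exact (key 1).trans_le h1
  · refine le_of_eq ?_
    by_contra hne
    have hmem : (2 : Fin 3) ∈ (polyOfXY C c).vars := by
      rw [MvPolynomial.mem_vars_iff_degreeOf_ne_zero]
      exact hne
    have := MvPolynomial.vars_rename (Fin.castSucc : Fin 2 → Fin 3) c hmem
    simp at this

/-- Linear systems `∑ cᵢ Pᵢ = Q S_k(Y) - R Y` with more unknown coefficients than equations have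
a nontrivial solution. -/
theorem exists_solution (r d h : ℕ) (e n : Fin 3 → ℕ) (P : Fin (r + 1) → PolyXYK C)
    (Q R : PolyXYK C) (y : Fin 3 → ℕ)
    (hP : ∀ i, P i ∈ degreeBox C e) (hQ : Q ∈ degreeBox C n) (hR : R ∈ degreeBox C n)
    (hy : ![d, h, 0] + e = n + y)
    (hlt : ∏ i, (n i + y i + 1) < (r + 1) * ((d + 1) * (h + 1)) + ∏ i, (y i + 1)) :
    ∃ (c : Fin (r + 1) → PolyXY C) (Y : PolyXYK C), (c ≠ 0 ∨ Y ≠ 0) ∧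
      (∀ i, (c i).degreeOf 0 ≤ d) ∧ (∀ i, (c i).degreeOf 1 ≤ h) ∧
      ∑ i, polyOfXY C (c i) * P i = Q * polyShift C 2 Y - R * Y := by
  let F : ((Fin (r + 1) → degreeBox C ![d, h]) × degreeBox C y) →ₗ[C] PolyXYK C :=
    (∑ i, LinearMap.mulRight C (P i) ∘ₗ (polyOfXY C).toLinearMap ∘ₗ
      (degreeBox C ![d, h]).subtype ∘ₗ LinearMap.proj i ∘ₗ LinearMap.fst C _ _) -
    (LinearMap.mulLeft C Q ∘ₗ (polyShift C 2).toLinearMap ∘ₗ (degreeBox C y).subtype ∘ₗ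
      LinearMap.snd C _ _) +
    (LinearMap.mulLeft C R ∘ₗ (degreeBox C y).subtype ∘ₗ LinearMap.snd C _ _)
  have hF : ∀ z, F z = ∑ i, polyOfXY C (z.1 i) * P i - Q * polyShift C 2 z.2 + R * z.2 := by
    intro z
    simp [F, LinearMap.sum_apply]
  have hmem : ∀ z, F z ∈ degreeBox C (n + y) := by
    intro z
    rw [hF]
    refine Submodule.add_mem _ (Submodule.sub_mem _ (Submodule.sum_mem _ fun i _ => ?_) ?_) ?_
    · rw [← hy]
      exact mul_mem_degreeBox (polyOfXY_mem_degreeBox (z.1 i).2) (hP i)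
    · exact mul_mem_degreeBox hQ (polyShift_mem_degreeBox 2 z.2.2)
    · exact mul_mem_degreeBox hR z.2.2
  have hker : LinearMap.ker (F.codRestrict (degreeBox C (n + y)) hmem) ≠ ⊥ := by
    apply LinearMap.ker_ne_bot_of_finrank_lt
    rw [Module.finrank_prod, Module.finrank_pi_fintype]
    simp only [finrank_degreeBox]
    simpa [Fin.prod_univ_two] using hlt
  obtain ⟨z, hz, hz0⟩ := Submodule.exists_mem_ne_zero_of_ne_bot hker
  rw [LinearMap.ker_codRestrict, LinearMap.mem_ker, hF] at hz
  refine ⟨fun i => z.1 i, z.2, ?_, fun i => mem_degreeBox.1 (z.1 i).2 0,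
    fun i => mem_degreeBox.1 (z.1 i).2 1, by linear_combination hz⟩
  by_contra! hcon
  refine hz0 (Prod.ext (funext fun i => Subtype.ext ?_) (Subtype.ext hcon.2))
  exact congrFun hcon.1 i

/-- The rising product `z (z + 1) ⋯ (z + n - 1)`. -/
def rise {R : Type*} [CommRing R] (z : R) (n : ℕ) : R := ∏ i ∈ Finset.range n, (z + i)

section Rise

variable {R : Type*} [CommRing R]

@[simp]
theorem rise_zero (z : R) : rise z 0 = 1 := by simp [rise]

theorem rise_add (z : R) (m n : ℕ) : rise z (m + n) = rise z m * rise (z + m) n := by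
  simp only [rise, Finset.prod_range_add, Nat.cast_add, add_assoc]

theorem rise_mul_rise_comm (z : R) (m n : ℕ) :
    rise z m * rise (z + m) n = rise z n * rise (z + n) m := by
  rw [← rise_add, ← rise_add, add_comm]

theorem map_rise {R' F : Type*} [CommRing R'] [FunLike F R R'] [RingHomClass F R R'] (f : F)
    (z : R) (n : ℕ) : f (rise z n) = rise (f z) n := by
  simp [rise]

theorem prod_sub_eq_rise (z : R) (n : ℕ) :
    ∏ i ∈ Finset.range n, (z - (i + 1)) = rise (z - n) n := by
  rw [rise, ← Finset.prod_range_reflect]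
  refine Finset.prod_congr rfl fun i hi => ?_
  have h : i + 1 + (n - 1 - i) = n := by have := Finset.mem_range.1 hi; omega
  have h' : (n : R) = i + 1 + ((n - 1 - i : ℕ) : R) := by
    exact_mod_cast congrArg (Nat.cast (R := R)) h.symm
  rw [h']
  ring

theorem gammaQuotient_natCast {K : Type*} [Field K] (z : K) (n : ℕ) :
    gammaQuotient z n = rise z n := rfl

theorem gammaQuotient_neg_natCast {K : Type*} [Field K] (z : K) (n : ℕ) :
    gammaQuotient z (-(n : ℤ)) = (rise (z - n) n)⁻¹ := by
  cases n with
  | zero => simpa using gammaQuotient_natCast z 0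
  | succ n => rw [← prod_sub_eq_rise]; rfl

end Rise

variable {C : Type*} [Field C]

section LinForm

theorem polyShift_ofY {i : Fin 3} (hi : i ≠ 1) (w : C[X]) :
    polyShift C i (ofY C w) = ofY C w := by
  rw [ofY, ← Polynomial.aeval_algHom_apply, polyShift_X, if_neg hi.symm]

theorem polyShift_zero_linForm (s t : ℤ) (w : C[X]) :
    polyShift C 0 (linForm s t w) = linForm s t w + s := by
  simp only [linForm, map_add, map_mul, map_intCast, polyShift_X,
    polyShift_ofY (show (0 : Fin 3) ≠ 1 by decide)]
  rw [if_pos trivial, if_neg (by decide)]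
  ring

theorem polyShift_two_linForm (s t : ℤ) (w : C[X]) :
    polyShift C 2 (linForm s t w) = linForm s t w + t := by
  simp only [linForm, map_add, map_mul, map_intCast, polyShift_X,
    polyShift_ofY (show (2 : Fin 3) ≠ 1 by decide)]
  rw [if_pos trivial, if_neg (by decide)]
  ring

theorem linForm_add_intCast (s t : ℤ) (w : C[X]) (n : ℤ) :
    linForm s t (w + (n : C[X])) = linForm s t w + (n : PolyXYK C) := by
  simp [linForm, add_assoc]

theorem linForm_add_natCast (s t : ℤ) (w : C[X]) (n : ℕ) :
    linForm s t (w + (n : C[X])) = linForm s t w + (n : PolyXYK C) := by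
  simp [linForm, add_assoc]

theorem linForm_ne_zero [CharZero C] {s t : ℤ} (h : s ≠ 0 ∨ t ≠ 0) (w : C[X]) :
    linForm s t w ≠ 0 := by
  intro h0
  rcases h with h | h
  · have := polyShift_zero_linForm s t w
    rw [h0, map_zero, zero_add] at this
    exact h (by exact_mod_cast this.symm)
  · have := polyShift_two_linForm s t w
    rw [h0, map_zero, zero_add] at this
    exact h (by exact_mod_cast this.symm)

theorem rise_linForm_add_ne_zero [CharZero C] {s t : ℤ} (w : C[X]) (j : ℤ) {n : ℕ}
    (h : n ≠ 0 → s ≠ 0 ∨ t ≠ 0) : rise (linForm s t w + (j : PolyXYK C)) n ≠ 0 := by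
  refine Finset.prod_ne_zero_iff.2 fun i hi => ?_
  rw [← linForm_add_intCast, ← linForm_add_natCast]
  exact linForm_ne_zero (h (by rintro rfl; simp at hi)) _

theorem rise_linForm_ne_zero [CharZero C] {s t : ℤ} (w : C[X]) {n : ℕ}
    (h : n ≠ 0 → s ≠ 0 ∨ t ≠ 0) : rise (linForm s t w) n ≠ 0 := by
  simpa using rise_linForm_add_ne_zero w 0 h

end LinForm

section Embedding

variable (E : Type*) [Field E] [Algebra (RatXYK C) E]

/-- The embedding of `C[x, y, k]` into `E`. -/
def ofPoly : PolyXYK C →+* E :=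
  (algebraMap (RatXYK C) E).comp (algebraMap (PolyXYK C) (RatXYK C))

theorem ofPoly_injective : Function.Injective (ofPoly (C := C) E) :=
  (algebraMap (RatXYK C) E).injective.comp (IsFractionRing.injective (PolyXYK C) (RatXYK C))

variable {E}

theorem ofPoly_ne_zero {p : PolyXYK C} (hp : p ≠ 0) : ofPoly E p ≠ 0 :=
  (map_ne_zero_iff _ (ofPoly_injective E)).2 hp

theorem ratShift_algebraMap (i : Fin 3) (p : PolyXYK C) :
    ratShift C i (algebraMap _ _ p) = algebraMap _ _ (polyShift C i p) := by
  simp [ratShift]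

variable (S : ShiftExtension C E)

theorem ShiftExtension.Sx_ofPoly (p : PolyXYK C) :
    S.Sx (ofPoly E p) = ofPoly E (polyShift C 0 p) := by
  simp [ofPoly, S.Sx_algebraMap, ratShift_algebraMap]

theorem ShiftExtension.Sk_ofPoly (p : PolyXYK C) :
    S.Sk (ofPoly E p) = ofPoly E (polyShift C 2 p) := by
  simp [ofPoly, S.Sk_algebraMap, ratShift_algebraMap]

theorem ShiftExtension.Sx_pow_ofPoly (p : PolyXYK C) (i : ℕ) :
    (S.Sx ^ i) (ofPoly E p) = ofPoly E ((polyShift C 0)^[i] p) := by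
  induction i with
  | zero => simp
  | succ i ih =>
    rw [pow_succ', RingHom.mul_def, RingHom.comp_apply, ih, S.Sx_ofPoly,
      Function.iterate_succ_apply']

theorem algebraMap_gammaQuotient_natCast (z : PolyXYK C) (n : ℕ) :
    algebraMap (RatXYK C) E (gammaQuotient (algebraMap (PolyXYK C) (RatXYK C) z) n) =
      ofPoly E (rise z n) := by
  rw [gammaQuotient_natCast, ← map_rise, ofPoly, RingHom.comp_apply]

theorem algebraMap_gammaQuotient_neg (z : PolyXYK C) (n : ℕ) :
    algebraMap (RatXYK C) E (gammaQuotient (algebraMap (PolyXYK C) (RatXYK C) z) (-(n : ℤ))) =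
      (ofPoly E (rise (z - (n : PolyXYK C)) n))⁻¹ := by
  rw [gammaQuotient_neg_natCast, map_inv₀, map_rise, map_sub, map_natCast, map_rise]
  simp [ofPoly]

variable {S}

theorem IsPowX.Sx_pow {α : C[X]} {g : E} (hg : IsPowX S α g) (i : ℕ) :
    (S.Sx ^ i) g = ofPoly E (ofY C α ^ i) * g := by
  induction i with
  | zero => simp
  | succ i ih =>
    rw [pow_succ', RingHom.mul_def, RingHom.comp_apply, ih, map_mul, S.Sx_ofPoly, hg.2.1, map_pow,
      polyShift_ofY (by decide), pow_succ, map_mul, mul_assoc]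
    rfl

theorem IsPowK.Sx_pow {β : C[X]} {g : E} (hg : IsPowK S β g) (i : ℕ) : (S.Sx ^ i) g = g := by
  rw [RingHom.coe_pow, Function.iterate_fixed hg.2.1]

variable {s : ℕ} {w : C[X]} {g : E}

theorem IsGamma.Sx_pow {t : ℤ} (hg : IsGamma S s t w g) (i : ℕ) :
    (S.Sx ^ i) g = ofPoly E (rise (linForm s t w) (s * i)) * g := by
  induction i with
  | zero => simp
  | succ i ih =>
    rw [pow_succ', RingHom.mul_def, RingHom.comp_apply, ih, map_mul, S.Sx_ofPoly, hg.2.1, map_rise,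
      polyShift_zero_linForm, algebraMap_gammaQuotient_natCast, ← mul_assoc, ← map_mul, mul_add_one,
      add_comm (s * i), rise_add, mul_comm (rise _ s), Int.cast_natCast]

theorem IsGamma.Sk_of_nonneg {t : ℕ} (hg : IsGamma S s t w g) :
    S.Sk g = ofPoly E (rise (linForm s t w) t) * g := by
  rw [hg.2.2, algebraMap_gammaQuotient_natCast]

theorem IsGamma.Sk_of_nonpos {t : ℕ} (hg : IsGamma S s (-(t : ℤ)) w g) :
    S.Sk g = (ofPoly E (rise (linForm s (-(t : ℤ)) w - (t : PolyXYK C)) t))⁻¹ * g := by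
  rw [hg.2.2, algebraMap_gammaQuotient_neg]

theorem IsGamma.mul_rise_of_nonneg {t : ℕ} (hg : IsGamma S s t w g) {n : ℕ}
    (hn : rise (linForm s t w) n ≠ 0) :
    IsGamma S s t (w + (n : C[X])) (ofPoly E (rise (linForm s t w) n) * g) := by
  refine ⟨mul_ne_zero (ofPoly_ne_zero hn) hg.1, ?_, ?_⟩
  · rw [map_mul, hg.2.1, S.Sx_ofPoly, map_rise, polyShift_zero_linForm, linForm_add_natCast,
      algebraMap_gammaQuotient_natCast, algebraMap_gammaQuotient_natCast, ← mul_assoc, ← mul_assoc,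
      ← map_mul, ← map_mul, Int.cast_natCast, mul_comm (rise _ n), rise_mul_rise_comm,
      mul_comm (rise _ n)]
  · rw [map_mul, hg.2.2, S.Sk_ofPoly, map_rise, polyShift_two_linForm, linForm_add_natCast,
      algebraMap_gammaQuotient_natCast, algebraMap_gammaQuotient_natCast, ← mul_assoc, ← mul_assoc,
      ← map_mul, ← map_mul, Int.cast_natCast, mul_comm (rise _ n), rise_mul_rise_comm,
      mul_comm (rise _ n)]

theorem IsGamma.mul_rise_of_nonpos [CharZero C] {t : ℕ} (hg : IsGamma S s (-(t : ℤ)) w g) {n : ℕ}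
    (hn : rise (linForm s (-(t : ℤ)) w) n ≠ 0) :
    IsGamma S s (-(t : ℤ)) (w + (n : C[X])) (ofPoly E (rise (linForm s (-(t : ℤ)) w) n) * g) := by
  refine ⟨mul_ne_zero (ofPoly_ne_zero hn) hg.1, ?_, ?_⟩
  · rw [map_mul, hg.2.1, S.Sx_ofPoly, map_rise, polyShift_zero_linForm, linForm_add_natCast,
      algebraMap_gammaQuotient_natCast, algebraMap_gammaQuotient_natCast, ← mul_assoc, ← mul_assoc,
      ← map_mul, ← map_mul, Int.cast_natCast, mul_comm (rise _ n), rise_mul_rise_comm,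
      mul_comm (rise _ n)]
  · rw [map_mul, hg.2.2, S.Sk_ofPoly, map_rise, polyShift_two_linForm, linForm_add_natCast,
      algebraMap_gammaQuotient_neg, algebraMap_gammaQuotient_neg, Int.cast_neg, Int.cast_natCast,
      ← sub_eq_add_neg, add_sub_right_comm]
    have h0 : ofPoly E (rise (linForm s (-(t : ℤ)) w - (t : PolyXYK C)) t) ≠ 0 := by
      refine ofPoly_ne_zero ?_
      simpa [sub_eq_add_neg] using rise_linForm_add_ne_zero (s := s) (t := -t) w (-t) (n := t)
        (fun h => .inr (by simpa using h))
    have h1 : ofPoly E (rise (linForm s (-(t : ℤ)) w - (t : PolyXYK C) + (n : PolyXYK C)) t) ≠ 0 := by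
      refine ofPoly_ne_zero ?_
      simpa [sub_eq_add_neg, add_assoc] using
        rise_linForm_add_ne_zero (s := s) (t := -t) w (-t + n) (n := t)
        (fun h => .inr (by simpa using h))
    have key : ofPoly E (rise (linForm s (-(t : ℤ)) w - (t : PolyXYK C)) n) *
        ofPoly E (rise (linForm s (-(t : ℤ)) w - (t : PolyXYK C) + (n : PolyXYK C)) t) =
        ofPoly E (rise (linForm s (-(t : ℤ)) w - (t : PolyXYK C)) t) *
        ofPoly E (rise (linForm s (-(t : ℤ)) w) n) := by
      rw [← map_mul, ← map_mul, ← rise_add, add_comm n t, rise_add, sub_add_cancel]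
    field_simp
    linear_combination g * key

end Embedding

section Hypergeometric

variable {C : Type*} [Field C] {E : Type*} [Field E] [Algebra (RatXYK C) E]
  {S : ShiftExtension C E}

theorem isHypergeometric_of_eq {H : E} (h0 : H ≠ 0) {q q' : RatXYK C}
    (hq : S.Sx H = algebraMap (RatXYK C) E q * H) (hq' : S.Sk H = algebraMap (RatXYK C) E q' * H) :
    IsHypergeometric S H :=
  ⟨h0, ⟨q, by rw [hq, mul_div_cancel_right₀ _ h0]⟩, ⟨q', by rw [hq', mul_div_cancel_right₀ _ h0]⟩⟩

theorem IsHypergeometric.mul {H H' : E} (h : IsHypergeometric S H) (h' : IsHypergeometric S H') :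
    IsHypergeometric S (H * H') := by
  obtain ⟨h0, ⟨q, hq⟩, ⟨s, hs⟩⟩ := h
  obtain ⟨h0', ⟨q', hq'⟩, ⟨s', hs'⟩⟩ := h'
  refine ⟨mul_ne_zero h0 h0', ⟨q * q', ?_⟩, ⟨s * s', ?_⟩⟩
  · rw [map_mul, map_mul, ← hq, ← hq', div_mul_div_comm]
  · rw [map_mul, map_mul, ← hs, ← hs', div_mul_div_comm]

theorem IsHypergeometric.inv {H : E} (h : IsHypergeometric S H) : IsHypergeometric S H⁻¹ := by
  obtain ⟨h0, ⟨q, hq⟩, ⟨s, hs⟩⟩ := h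
  refine ⟨inv_ne_zero h0, ⟨q⁻¹, ?_⟩, ⟨s⁻¹, ?_⟩⟩
  · rw [map_inv₀, map_inv₀, ← hq, inv_div_inv, inv_div]
  · rw [map_inv₀, map_inv₀, ← hs, inv_div_inv, inv_div]

theorem isHypergeometric_one : IsHypergeometric S (1 : E) :=
  isHypergeometric_of_eq one_ne_zero (q := 1) (q' := 1) (by simp) (by simp)

theorem isHypergeometric_prod {ι : Type*} (s : Finset ι) (f : ι → E)
    (h : ∀ i, IsHypergeometric S (f i)) : IsHypergeometric S (∏ i ∈ s, f i) :=
  Finset.prod_induction f (IsHypergeometric S) (fun _ _ => IsHypergeometric.mul)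
    isHypergeometric_one fun i _ => h i

theorem isHypergeometric_algebraMap {f : RatXYK C} (hf : f ≠ 0) :
    IsHypergeometric S (algebraMap (RatXYK C) E f) := by
  have hf' : algebraMap (RatXYK C) E f ≠ 0 := by simpa using hf
  refine isHypergeometric_of_eq hf' (q := ratShift C 0 f / f) (q' := ratShift C 2 f / f) ?_ ?_
  · rw [S.Sx_algebraMap, map_div₀, div_mul_cancel₀ _ hf']
  · rw [S.Sk_algebraMap, map_div₀, div_mul_cancel₀ _ hf']

theorem IsPowX.isHypergeometric {α : C[X]} {g : E} (hg : IsPowX S α g) : IsHypergeometric S g :=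
  isHypergeometric_of_eq hg.1 hg.2.1 (q' := 1) (by simpa using hg.2.2)

theorem IsPowK.isHypergeometric {β : C[X]} {g : E} (hg : IsPowK S β g) : IsHypergeometric S g :=
  isHypergeometric_of_eq hg.1 (q := 1) (by simpa using hg.2.1) hg.2.2

theorem IsGamma.isHypergeometric {s t : ℤ} {w : C[X]} {g : E} (hg : IsGamma S s t w g) :
    IsHypergeometric S g :=
  isHypergeometric_of_eq hg.1 hg.2.1 hg.2.2

theorem ProperForm.IsFormOf.isHypergeometric {D : ProperForm C} {H : E} (hH : D.IsFormOf S H) :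
    IsHypergeometric S H := by
  obtain ⟨ex, ek, gA, gB, gU, gV, hx, hk, hA, hB, hU, hV, rfl⟩ := hH
  refine (((isHypergeometric_algebraMap ?_).mul hx.isHypergeometric).mul
    hk.isHypergeometric).mul (isHypergeometric_prod _ _ fun m => ?_)
  · simpa using D.p_ne_zero
  · rw [div_eq_mul_inv]
    exact ((hA m).isHypergeometric.mul (hB m).isHypergeometric).mul
      ((hU m).isHypergeometric.mul (hV m).isHypergeometric).inv

end Hypergeometric

namespace ProperForm

variable {C : Type*} [Field C] (D : ProperForm C)

/-- The quotient of `S_x^i(H)` by the base term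
`α^x β^k ∏ Γ(Aₘ) Γ(Bₘ) / (Γ(Uₘ + r uₘ) Γ(Vₘ + r vₘ))`, for `i ≤ r`. -/
def xNumerator (r i : ℕ) : PolyXYK C :=
  (polyShift C 0)^[i] D.p * ofY C D.α ^ i *
    ∏ m, (rise (D.A m) (D.a m * i) * rise (D.B m) (D.b m * i) *
      (rise (D.U m + ((D.u m * i : ℕ) : PolyXYK C)) (D.u m * (r - i)) *
        rise (D.V m + ((D.v m * i : ℕ) : PolyXYK C)) (D.v m * (r - i))))

/-- The numerator of the quotient of `S_k` of the base term by the base term. -/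
def kNumerator (r : ℕ) : PolyXYK C :=
  ofY C D.β * ∏ m, (rise (D.A m) (D.a1 m) *
    rise (D.V m + ((D.v m * r : ℕ) : PolyXYK C) - (D.v1 m : PolyXYK C)) (D.v1 m))

/-- The polynomial whose image under `S_k` is the denominator of the quotient of `S_k` of the base
term by the base term. -/
def kDenominator (r : ℕ) : PolyXYK C :=
  ∏ m, (rise (D.U m + ((D.u m * r : ℕ) : PolyXYK C) - (D.u1 m : PolyXYK C)) (D.u1 m) *
    rise (D.B m) (D.b1 m))

/-- The form with `Uₘ` and `Vₘ` replaced by `Uₘ + r uₘ` and `Vₘ + r vₘ`, and `p` replaced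
by `q`. -/
def shifted (r : ℕ) (q : PolyXYK C) (hq : q ≠ 0) : ProperForm C :=
  { D with
    p := q
    p_ne_zero := hq
    u2 := fun m => D.u2 m + ((D.u m * r : ℕ) : C[X])
    v2 := fun m => D.v2 m + ((D.v m * r : ℕ) : C[X]) }

theorem kDenominator_ne_zero [CharZero C] (r : ℕ) : D.kDenominator r ≠ 0 := by
  refine Finset.prod_ne_zero_iff.2 fun m _ => mul_ne_zero ?_ ?_
  · have := rise_linForm_add_ne_zero (s := D.u m) (t := D.u1 m) (D.u2 m)
      ((D.u m * r : ℕ) - D.u1 m : ℤ) (n := D.u1 m) fun h => .inr (by exact_mod_cast h)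
    simpa [U, add_sub_assoc] using this
  · exact rise_linForm_ne_zero _ fun h => .inr (by simpa using h)

theorem polyShift_kDenominator (r : ℕ) : polyShift C 2 (D.kDenominator r) =
    ∏ m, (rise (D.U m + ((D.u m * r : ℕ) : PolyXYK C)) (D.u1 m) *
      rise (D.B m - (D.b1 m : PolyXYK C)) (D.b1 m)) := by
  rw [kDenominator, map_prod]
  refine Finset.prod_congr rfl fun m _ => ?_
  rw [map_mul, map_rise, map_rise, map_sub, map_add, map_natCast, map_natCast, U, B,
    polyShift_two_linForm, polyShift_two_linForm]
  congr 2
  · push_cast; ring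
  · push_cast; ring

section Base

variable {D} {E : Type*} [Field E] [Algebra (RatXYK C) E] {S : ShiftExtension C E}

theorem IsFormOf.exists_base [CharZero C] {H : E} (hH : D.IsFormOf S H) (r : ℕ) :
    ∃ H₁ : E, (∀ q hq, (D.shifted r q hq).IsFormOf S (ofPoly E q * H₁)) ∧
      (∀ i ≤ r, S.Sx^[i] H = ofPoly E (D.xNumerator r i) * H₁) ∧
      ofPoly E (polyShift C 2 (D.kDenominator r)) * S.Sk H₁ =
        ofPoly E (D.kNumerator r) * H₁ := by
  obtain ⟨ex, ek, gA, gB, gU, gV, hx, hk, hA, hB, hU, hV, rfl⟩ := hH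
  have hU0 : ∀ m, rise (D.U m) (D.u m * r) ≠ 0 := fun m =>
    rise_linForm_ne_zero _ fun h => .inl (by simpa using left_ne_zero_of_mul h)
  have hV0 : ∀ m, rise (D.V m) (D.v m * r) ≠ 0 := fun m =>
    rise_linForm_ne_zero _ fun h => .inl (by simpa using left_ne_zero_of_mul h)
  have hU' := fun m => (hU m).mul_rise_of_nonneg (hU0 m)
  have hV' := fun m => (hV m).mul_rise_of_nonpos (hV0 m)
  refine ⟨ex * ek * ∏ m, (gA m * gB m) / ((ofPoly E (rise (D.U m) (D.u m * r)) * gU m) *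
    (ofPoly E (rise (D.V m) (D.v m * r)) * gV m)), fun q hq => ?_, fun i hi => ?_, ?_⟩
  · refine ⟨ex, ek, gA, gB, _, _, hx, hk, hA, hB, hU', hV', ?_⟩
    rw [← mul_assoc, ← mul_assoc]
    rfl
  · rw [← RingHom.coe_pow, map_mul, map_mul, map_mul, map_prod, hx.Sx_pow, hk.Sx_pow]
    change (S.Sx ^ i) (ofPoly E D.p) * _ * _ * _ = _
    rw [S.Sx_pow_ofPoly, xNumerator, map_mul, map_mul, map_prod]
    have hm : ∀ m, (S.Sx ^ i) (gA m * gB m / (gU m * gV m)) =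
        ofPoly E (rise (D.A m) (D.a m * i) * rise (D.B m) (D.b m * i) *
      (rise (D.U m + ((D.u m * i : ℕ) : PolyXYK C)) (D.u m * (r - i)) *
        rise (D.V m + ((D.v m * i : ℕ) : PolyXYK C)) (D.v m * (r - i)))) *
        ((gA m * gB m) / ((ofPoly E (rise (D.U m) (D.u m * r)) * gU m) *
    (ofPoly E (rise (D.V m) (D.v m * r)) * gV m))) := by
      intro m
      have eU : rise (D.U m) (D.u m * r) = rise (D.U m) (D.u m * i) *
          rise (D.U m + ((D.u m * i : ℕ) : PolyXYK C)) (D.u m * (r - i)) := by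
        rw [← rise_add, ← mul_add, Nat.add_sub_cancel' hi]
      have eV : rise (D.V m) (D.v m * r) = rise (D.V m) (D.v m * i) *
          rise (D.V m + ((D.v m * i : ℕ) : PolyXYK C)) (D.v m * (r - i)) := by
        rw [← rise_add, ← mul_add, Nat.add_sub_cancel' hi]
      have nU := hU0 m
      have nV := hV0 m
      rw [eU] at nU
      rw [eV] at nV
      have nU1 := ofPoly_ne_zero (E := E) (left_ne_zero_of_mul nU)
      have nU2 := ofPoly_ne_zero (E := E) (right_ne_zero_of_mul nU)
      have nV1 := ofPoly_ne_zero (E := E) (left_ne_zero_of_mul nV)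
      have nV2 := ofPoly_ne_zero (E := E) (right_ne_zero_of_mul nV)
      have gU0 := (hU m).1
      have gV0 := (hV m).1
      rw [map_div₀, map_mul, map_mul, (hA m).Sx_pow, (hB m).Sx_pow, (hU m).Sx_pow, (hV m).Sx_pow]
      change (ofPoly E (rise (D.A m) _) * _) * (ofPoly E (rise (D.B m) _) * _) /
        ((ofPoly E (rise (D.U m) _) * _) * (ofPoly E (rise (D.V m) _) * _)) = _
      rw [eU, eV]
      simp only [map_mul]
      field_simp
    rw [Finset.prod_congr rfl fun m _ => hm m, Finset.prod_mul_distrib]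
    ring
  · rw [polyShift_kDenominator, kNumerator, map_mul, map_mul, map_prod, map_prod, map_mul, map_prod,
      hx.2.2, hk.2.2]
    change _ * (ex * (ofPoly E (ofY C D.β) * ek) * _) = _
    have hm : ∀ m, ofPoly E (rise (D.U m + ((D.u m * r : ℕ) : PolyXYK C)) (D.u1 m) *
        rise (D.B m - (D.b1 m : PolyXYK C)) (D.b1 m)) *
        S.Sk ((gA m * gB m) / ((ofPoly E (rise (D.U m) (D.u m * r)) * gU m) *
          (ofPoly E (rise (D.V m) (D.v m * r)) * gV m))) =
        ofPoly E (rise (D.A m) (D.a1 m) *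
          rise (D.V m + ((D.v m * r : ℕ) : PolyXYK C) - (D.v1 m : PolyXYK C)) (D.v1 m)) *
        ((gA m * gB m) / ((ofPoly E (rise (D.U m) (D.u m * r)) * gU m) *
          (ofPoly E (rise (D.V m) (D.v m * r)) * gV m))) := by
      intro m
      have eU := (hU' m).Sk_of_nonneg
      have eV := (hV' m).Sk_of_nonpos
      have nU := (map_ne_zero S.Sk).2 (hU' m).1
      have nV := (map_ne_zero S.Sk).2 (hV' m).1
      have nB := (map_ne_zero S.Sk).2 (hB m).1
      rw [eU] at nU
      rw [eV] at nV
      rw [(hB m).Sk_of_nonpos] at nB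
      rw [linForm_add_natCast] at eU eV nU nV
      change S.Sk (ofPoly E (rise (D.U m) _) * _) = ofPoly E (rise (D.U m + _) _) *
        (ofPoly E (rise (D.U m) _) * _) at eU
      change S.Sk (ofPoly E (rise (D.V m) _) * _) = (ofPoly E (rise (D.V m + _ - _) _))⁻¹ *
        (ofPoly E (rise (D.V m) _) * _) at eV
      rw [map_div₀, map_mul S.Sk (gA m), map_mul S.Sk (_ * _), eU, eV, (hA m).Sk_of_nonneg,
        (hB m).Sk_of_nonpos]
      change _ * (ofPoly E (rise (D.A m) _) * _ * ((ofPoly E (rise (D.B m - _) _))⁻¹ * _) / _) = _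
      have nU1 : ofPoly E (rise (D.U m + ((D.u m * r : ℕ) : PolyXYK C)) (D.u1 m)) ≠ 0 :=
        left_ne_zero_of_mul nU
      have nV1 : ofPoly E (rise (D.V m + ((D.v m * r : ℕ) : PolyXYK C) - (D.v1 m : PolyXYK C))
          (D.v1 m)) ≠ 0 := fun h0 => left_ne_zero_of_mul nV (by rw [inv_eq_zero]; exact h0)
      have nB1 : ofPoly E (rise (D.B m - (D.b1 m : PolyXYK C)) (D.b1 m)) ≠ 0 :=
        fun h0 => left_ne_zero_of_mul nB (by rw [inv_eq_zero]; exact h0)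
      have nU2 := ofPoly_ne_zero (E := E) (hU0 m)
      have nV2 := ofPoly_ne_zero (E := E) (hV0 m)
      have gU0 := (hU m).1
      have gV0 := (hV m).1
      simp only [map_mul]
      field_simp
    have hp := Finset.prod_congr (rfl : Finset.univ = Finset.univ) fun m _ => hm m
    rw [Finset.prod_mul_distrib, Finset.prod_mul_distrib] at hp
    linear_combination (ex * ofPoly E (ofY C D.β) * ek) * hp

end Base

end ProperForm

section Degree

variable {C : Type*} [Field C]

theorem natCast_mem_degreeBox {σ : Type*} (j : ℕ) (n : σ → ℕ) :
    (j : MvPolynomial σ C) ∈ degreeBox C n := by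
  simpa using C_mem_degreeBox (j : C) n

theorem rise_mem_degreeBox {σ : Type*} {n : σ → ℕ} {z : MvPolynomial σ C} (hz : z ∈ degreeBox C n)
    (k : ℕ) : rise z k ∈ degreeBox C (k • n) := by
  simpa [rise] using prod_mem_degreeBox (Finset.range k) (fun _ => n) (fun j => z + (j : MvPolynomial σ C))
    fun j _ => Submodule.add_mem _ hz (natCast_mem_degreeBox j n)

theorem iterate_polyShift_mem_degreeBox (i : Fin 3) {n : Fin 3 → ℕ} {p : PolyXYK C}
    (hp : p ∈ degreeBox C n) (k : ℕ) : (polyShift C i)^[k] p ∈ degreeBox C n := by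
  induction k with
  | zero => exact hp
  | succ k ih => rw [Function.iterate_succ_apply']; exact polyShift_mem_degreeBox i ih

theorem ofY_mem_degreeBox (w : C[X]) : ofY C w ∈ degreeBox C ![0, w.natDegree, 0] := by
  rw [ofY, Polynomial.aeval_eq_sum_range]
  refine Submodule.sum_mem _ fun i hi => Submodule.smul_mem _ _ ?_
  refine degreeBox_mono (fun j => ?_) (pow_mem_degreeBox (X_mem_degreeBox 1) i)
  have := Finset.mem_range_succ_iff.1 hi
  fin_cases j <;> simp [this]

theorem intCast_mul_X_mem_degreeBox (s : ℤ) (i : Fin 3) :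
    (s : PolyXYK C) * MvPolynomial.X i ∈ degreeBox C (Pi.single i 1) := by
  have hs : (s : PolyXYK C) ∈ degreeBox C 0 := by
    simpa using C_mem_degreeBox (s : C) (0 : Fin 3 → ℕ)
  simpa using mul_mem_degreeBox hs (X_mem_degreeBox i)

theorem linForm_mem_degreeBox (s t : ℤ) (w : C[X]) :
    linForm s t w ∈ degreeBox C ![1, (linForm s t w).degreeOf 1, 1] := by
  have h : linForm s t w ∈ degreeBox C ![1, w.natDegree, 1] := by
    refine Submodule.add_mem _ (Submodule.add_mem _ ?_ ?_) ?_
    · refine degreeBox_mono (fun j => ?_) (intCast_mul_X_mem_degreeBox s 0)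
      fin_cases j <;> simp
    · refine degreeBox_mono (fun j => ?_) (intCast_mul_X_mem_degreeBox t 2)
      fin_cases j <;> simp
    · refine degreeBox_mono (fun j => ?_) (ofY_mem_degreeBox w)
      fin_cases j <;> simp
  rw [mem_degreeBox] at *
  intro j
  have h0 := h 0
  have h2 := h 2
  fin_cases j
  · exact h0
  · exact le_rfl
  · exact h2

namespace ProperForm

variable (D : ProperForm C)

theorem xNumerator_mem_degreeBox {r i : ℕ} (hi : i ≤ r) : D.xNumerator r i ∈ degreeBox C
    ![D.thetaX + r * D.mu, D.thetaY + r * D.xi, D.thetaK + r * D.mu] := by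
  have hp : D.p ∈ degreeBox C ![D.thetaX, D.thetaY, D.thetaK] := by
    rw [mem_degreeBox]
    intro j
    fin_cases j <;> exact le_rfl
  have key := mul_mem_degreeBox (mul_mem_degreeBox (iterate_polyShift_mem_degreeBox 0 hp i)
    (pow_mem_degreeBox (ofY_mem_degreeBox D.α) i)) (prod_mem_degreeBox Finset.univ _ _ fun m _ =>
    mul_mem_degreeBox (mul_mem_degreeBox
      (rise_mem_degreeBox (linForm_mem_degreeBox (D.a m) (D.a1 m) (D.a2 m)) (D.a m * i))
      (rise_mem_degreeBox (linForm_mem_degreeBox (D.b m) (-(D.b1 m : ℤ)) (D.b2 m)) (D.b m * i)))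
      (mul_mem_degreeBox
      (rise_mem_degreeBox (Submodule.add_mem _ (linForm_mem_degreeBox (D.u m) (D.u1 m) (D.u2 m))
        (natCast_mem_degreeBox (D.u m * i) _)) (D.u m * (r - i)))
      (rise_mem_degreeBox (Submodule.add_mem _
        (linForm_mem_degreeBox (D.v m) (-(D.v1 m : ℤ)) (D.v2 m))
        (natCast_mem_degreeBox (D.v m * i) _)) (D.v m * (r - i)))))
  refine degreeBox_mono (fun j => ?_) key
  obtain ⟨l, rfl⟩ := Nat.exists_eq_add_of_le hi
  have hmu : i * (∑ m, (D.a m + D.b m)) + l * (∑ m, (D.u m + D.v m)) ≤ (i + l) * D.mu := by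
    rw [add_mul]
    gcongr
    · exact le_max_left _ _
    · exact le_max_right _ _
  have hxi : i * (D.α.natDegree +
      ∑ m, (D.a m * (D.A m).degreeOf 1 + D.b m * (D.B m).degreeOf 1)) +
      l * (∑ m, (D.u m * (D.U m).degreeOf 1 + D.v m * (D.V m).degreeOf 1)) ≤ (i + l) * D.xi := by
    rw [add_mul]
    gcongr
    · exact le_max_left _ _
    · exact le_max_right _ _
  fin_cases j
  · refine le_trans (le_of_eq ?_) (Nat.add_le_add_left hmu D.thetaX)
    simp [Finset.sum_apply, Finset.mul_sum, Finset.sum_add_distrib, mul_comm, mul_add]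
  · refine le_trans (le_of_eq ?_) (Nat.add_le_add_left hxi D.thetaY)
    simp [Finset.sum_apply, Finset.mul_sum, Finset.sum_add_distrib, mul_add, A, B, U, V,
      mul_left_comm, mul_assoc]
    ring
  · refine le_trans (le_of_eq ?_) (Nat.add_le_add_left hmu D.thetaK)
    simp [Finset.sum_apply, Finset.mul_sum, Finset.sum_add_distrib, mul_comm, mul_add]

theorem kNumerator_mem_degreeBox (r : ℕ) :
    D.kNumerator r ∈ degreeBox C ![D.nu, D.eta, D.nu] := by
  have key := mul_mem_degreeBox (ofY_mem_degreeBox D.β)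
    (prod_mem_degreeBox Finset.univ _ _ fun m _ => mul_mem_degreeBox
      (rise_mem_degreeBox (linForm_mem_degreeBox (D.a m) (D.a1 m) (D.a2 m)) (D.a1 m))
      (rise_mem_degreeBox (Submodule.sub_mem _ (Submodule.add_mem _
        (linForm_mem_degreeBox (D.v m) (-(D.v1 m : ℤ)) (D.v2 m))
        (natCast_mem_degreeBox (D.v m * r) _)) (natCast_mem_degreeBox (D.v1 m) _)) (D.v1 m)))
  refine degreeBox_mono (fun j => ?_) key
  have hnu : ∑ m, (D.a1 m + D.v1 m) ≤ D.nu := le_max_left _ _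
  fin_cases j
  · simpa [Finset.sum_apply] using hnu
  · refine le_trans (le_of_eq ?_) (le_max_left _ _)
    simp [Finset.sum_apply, A, V]
  · simpa [Finset.sum_apply] using hnu

theorem kDenominator_mem_degreeBox (r : ℕ) :
    D.kDenominator r ∈ degreeBox C ![D.nu, D.eta, D.nu] := by
  have key := prod_mem_degreeBox Finset.univ _ _ fun m _ => mul_mem_degreeBox
      (rise_mem_degreeBox (Submodule.sub_mem _ (Submodule.add_mem _
        (linForm_mem_degreeBox (D.u m) (D.u1 m) (D.u2 m))
        (natCast_mem_degreeBox (D.u m * r) _)) (natCast_mem_degreeBox (D.u1 m) _)) (D.u1 m))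
      (rise_mem_degreeBox (linForm_mem_degreeBox (D.b m) (-(D.b1 m : ℤ)) (D.b2 m)) (D.b1 m))
  refine degreeBox_mono (fun j => ?_) key
  have hnu : ∑ m, (D.u1 m + D.b1 m) ≤ D.nu := le_max_right _ _
  fin_cases j
  · simpa [Finset.sum_apply] using hnu
  · refine le_trans (le_of_eq ?_) (le_max_right _ _)
    simp [Finset.sum_apply, U, B]
  · simpa [Finset.sum_apply] using hnu

end ProperForm

end Degree

section Operators

variable {C : Type*} [Field C] {E : Type*} [Field E] [Algebra (RatXYK C) E]

/-- The operator `∑ cᵢ S_x^i`. -/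
def Operator.ofCoeffs {r : ℕ} (c : Fin (r + 1) → PolyXY C) : Operator C :=
  ∑ i : Fin (r + 1), SkewPolynomial.monomial (i : ℕ) (c i)

theorem Operator.coeff_ofCoeffs {r : ℕ} (c : Fin (r + 1) → PolyXY C) (n : ℕ) :
    SkewPolynomial.coeff (Operator.ofCoeffs c) n = if h : n < r + 1 then c ⟨n, h⟩ else 0 := by
  have h1 : SkewPolynomial.coeff (Operator.ofCoeffs c) n =
      ∑ i : Fin (r + 1), SkewPolynomial.coeff (SkewPolynomial.monomial (i : ℕ) (c i)) n := by
    let φ : Operator C →+ PolyXY C :=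
      { toFun := fun L => SkewPolynomial.coeff L n
        map_zero' := SkewPolynomial.coeff_zero n
        map_add' := fun L L' => by simp [SkewPolynomial.coeff] }
    exact map_sum φ _ _
  simp only [h1, SkewPolynomial.coeff_monomial]
  split_ifs with h
  · rw [Finset.sum_eq_single ⟨n, h⟩]
    · simp
    · intro i _ hi
      exact if_neg fun h' => hi (Fin.ext h')
    · simp
  · exact Finset.sum_eq_zero fun i _ => if_neg fun (h' : (i : ℕ) = n) => h (h' ▸ i.2)

theorem Operator.support_ofCoeffs {r : ℕ} (c : Fin (r + 1) → PolyXY C) :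
    SkewPolynomial.support (Operator.ofCoeffs c) ⊆ Finset.range (r + 1) := by
  intro n hn
  rw [SkewPolynomial.mem_support_iff, Operator.coeff_ofCoeffs] at hn
  by_contra h
  exact hn (dif_neg (by simpa using h))

theorem Operator.ofCoeffs_ne_zero {r : ℕ} {c : Fin (r + 1) → PolyXY C} (hc : c ≠ 0) :
    Operator.ofCoeffs c ≠ 0 := by
  intro h
  refine hc (funext fun i => ?_)
  have := Operator.coeff_ofCoeffs c i
  rw [h, SkewPolynomial.coeff_zero, dif_pos i.2] at this
  exact this.symm

theorem Operator.apply_ofCoeffs (S : ShiftExtension C E) {r : ℕ} (c : Fin (r + 1) → PolyXY C)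
    (H : E) : Operator.apply S (Operator.ofCoeffs c) H =
      ∑ i : Fin (r + 1), ofPoly E (polyOfXY C (c i)) * S.Sx^[i] H := by
  rw [Operator.apply, Finset.sum_subset (Operator.support_ofCoeffs c), Finset.sum_range]
  · refine Finset.sum_congr rfl fun i _ => ?_
    rw [Operator.coeff_ofCoeffs, dif_pos i.2]
    rfl
  · intro n _ hn
    rw [SkewPolynomial.notMem_support_iff.1 hn, map_zero, map_zero, zero_mul]

theorem Operator.order_ofCoeffs {r : ℕ} (c : Fin (r + 1) → PolyXY C) :
    Operator.order (Operator.ofCoeffs c) ≤ r :=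
  Finset.sup_le fun _ hn => Finset.mem_range_succ_iff.1 (Operator.support_ofCoeffs c hn)

theorem Operator.degree_ofCoeffs {r d : ℕ} {c : Fin (r + 1) → PolyXY C}
    (hc : ∀ i, (c i).degreeOf 0 ≤ d) : Operator.degree (Operator.ofCoeffs c) ≤ d := by
  refine Finset.sup_le fun n hn => ?_
  rw [Operator.coeff_ofCoeffs, dif_pos (Finset.mem_range.1 (Operator.support_ofCoeffs c hn))]
  exact hc _

theorem Operator.height_ofCoeffs {r h : ℕ} {c : Fin (r + 1) → PolyXY C}
    (hc : ∀ i, (c i).degreeOf 1 ≤ h) : Operator.height (Operator.ofCoeffs c) ≤ h := by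
  refine Finset.sup_le fun n hn => ?_
  rw [Operator.coeff_ofCoeffs, dif_pos (Finset.mem_range.1 (Operator.support_ofCoeffs c hn))]
  exact hc _

end Operators

end Telescoping

end

open Telescoping

theorem theorem2 {C : Type*} [Field C] [CharZero C]
    {E : Type*} [Field E] [Algebra (Telescoping.RatXYK C) E]
    (S : Telescoping.ShiftExtension C E)
    (D : Telescoping.ProperForm C) (H : E) (hH : D.IsFormOf S H)
    (hrat : ¬ Telescoping.IsRationalUpToConstant S H)
    (r d h : ℕ)
    (hx : 0 ≤ (d : ℤ) + D.thetaX + r * D.mu - D.nu)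
    (hy : 0 ≤ (h : ℤ) + D.thetaY + r * D.xi - D.eta)
    (hk : 0 ≤ (D.thetaK : ℤ) + r * D.mu - D.nu)
    (hineq : 0 < ((r : ℤ) + 1) * (d + 1) * (h + 1)
      - ((d : ℤ) + 1 + D.thetaX + r * D.mu) * (D.thetaK + r * D.mu + 1) * D.eta
      - ((d : ℤ) + 2 + D.thetaX + D.thetaK + 2 * r * D.mu - D.nu)
        * (h + 1 + D.thetaY + r * D.xi - D.eta) * D.nu) :
    ∃ L : Telescoping.Operator C, Telescoping.IsTelescoper S H L ∧
      Telescoping.Operator.order L ≤ r ∧ Telescoping.Operator.degree L ≤ d ∧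
      Telescoping.Operator.height L ≤ h := by
  obtain ⟨y0, hy0⟩ := Int.eq_ofNat_of_zero_le hx
  obtain ⟨y1, hy1⟩ := Int.eq_ofNat_of_zero_le hy
  obtain ⟨y2, hy2⟩ := Int.eq_ofNat_of_zero_le hk
  obtain ⟨c, Y, hcY, hcd, hch, heq⟩ := exists_solution r d h
    ![D.thetaX + r * D.mu, D.thetaY + r * D.xi, D.thetaK + r * D.mu] ![D.nu, D.eta, D.nu]
    (fun i : Fin (r + 1) => D.xNumerator r i) (D.kNumerator r) (D.kDenominator r) ![y0, y1, y2]
    (fun i => D.xNumerator_mem_degreeBox (Nat.lt_succ_iff.1 i.2)) (D.kNumerator_mem_degreeBox r)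
    (D.kDenominator_mem_degreeBox r)
    (by
      funext j
      zify
      fin_cases j
      · simpa using (by linear_combination hy0)
      · simpa using (by linear_combination hy1)
      · simpa using (by linear_combination hy2))
    (by
      zify
      simp only [Fin.prod_univ_three, Matrix.cons_val]
      rw [← hy0, ← hy1, ← hy2]
      linarith)
  obtain ⟨H₁, hform, hSx, hSk⟩ := hH.exists_base r
  have hH0 : H ≠ 0 := hH.isHypergeometric.1
  have hHbase : H = ofPoly E (D.xNumerator r 0) * H₁ := hSx 0 (Nat.zero_le r)
  have hP0 : D.xNumerator r 0 ≠ 0 := by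
    intro h0
    rw [h0, map_zero, zero_mul] at hHbase
    exact hH0 hHbase
  have hcert : S.Sk (ofPoly E (Y * D.kDenominator r) * H₁) -
      ofPoly E (Y * D.kDenominator r) * H₁ =
      ofPoly E (∑ i : Fin (r + 1), polyOfXY C (c i) * D.xNumerator r i) * H₁ := by
    rw [heq, map_mul S.Sk, S.Sk_ofPoly]
    simp only [map_mul, map_sub]
    linear_combination ofPoly E (polyShift C 2 Y) * hSk
  have hc : c ≠ 0 := by
    rintro rfl
    have hY : Y ≠ 0 := by simpa using hcY
    have hq : Y * D.kDenominator r ≠ 0 := mul_ne_zero hY (D.kDenominator_ne_zero r)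
    have hH₀ := hform _ hq
    refine hrat ⟨algebraMap _ _ (D.xNumerator r 0) / algebraMap _ _ (Y * D.kDenominator r),
      _, ⟨hH₀.isHypergeometric, _, hH₀⟩, ?_, ?_⟩
    · rw [div_eq_one_iff_eq hH₀.isHypergeometric.1, ← sub_eq_zero, hcert]
      simp
    · rw [map_div₀]
      change _ = ofPoly E _ / ofPoly E _ * _
      rw [← mul_assoc, div_mul_cancel₀ _ (ofPoly_ne_zero hq)]
      exact hHbase
  refine ⟨Operator.ofCoeffs c, ⟨Operator.ofCoeffs_ne_zero hc,
    algebraMap _ _ (Y * D.kDenominator r) / algebraMap _ _ (D.xNumerator r 0), ?_⟩,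
    Operator.order_ofCoeffs c, Operator.degree_ofCoeffs hcd, Operator.height_ofCoeffs hch⟩
  have hg : algebraMap (RatXYK C) E (algebraMap _ _ (Y * D.kDenominator r) /
      algebraMap _ _ (D.xNumerator r 0)) * H = ofPoly E (Y * D.kDenominator r) * H₁ := by
    rw [map_div₀]
    change ofPoly E _ / ofPoly E _ * _ = _
    nth_rewrite 1 [hHbase]
    rw [← mul_assoc, div_mul_cancel₀ _ (ofPoly_ne_zero hP0)]
  rw [hg, hcert, Operator.apply_ofCoeffs, map_sum, Finset.sum_mul]
  refine Finset.sum_congr rfl fun i _ => ?_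
  rw [hSx i (Nat.lt_succ_iff.1 i.2), map_mul, mul_assoc]
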